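/- \textbf{Setting.} Let $k\in\mathbb N$, $\chi=\{1,\dots,k\}$, and let $\lambda_{ij}:(0,\infty)\to[0,\infty)$ ($i\ne j$ in $\chi$) be measurable functions with $\sup_{y>0}\sum_{j\ne i}\lambda_{ij}(y)<\infty$ and $\lim_{y\to\infty}\int_0^y\sum_{j\ne i}\lambda_{ij}(v)\,dv=\infty$ for every $i\in\chi$. For $y>0$ let $\Lambda_{ij}(y)$, $i\neq j$, be the consecutive left-closed, right-open intervals of length $\lambda_{ij}(y)$, laid out from $0$ along the real line in the lexicographic order of the pairs $(i,j)$ (and $\Lambda_{ij}(0)=\emptyset$). Put $$h(i,y,z)=\sum_{j\ne i}(j-i)\mathbf 1_{\Lambda_{ij}(y)}(z),\qquad g(i,y,z)=y\sum_{j\ne i}\mathbf 1_{\Lambda_{ij}(y)}(z)\qquad(i\in\chi,\ y\ge 0,\ z\in\mathbb R).$$ Let $(\Omega,\mathcal F,\{\mathcal F_t\}_{t\ge0},P)$ be a filtered probability space, and let $\wp$ be a Poisson random measure on $[0,\infty)\times\mathbb R$ with intensity $du\times dz$ such that $\{\wp((0,t]\times dz)\}_{t\ge0}$ is adapted to $\{\mathcal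 F_t\}$. Let $(X_t,Y_t)_{t\ge 0}$ be a strong solution, with values in $\chi\times[0,\infty)$, of $$X_t=X_0+\int_{(0,t]}\int_{\mathbb R}h(X_{u-},Y_{u-},z)\,\wp(du,dz),\qquad Y_t=Y_0+t-\int_{(0,t]}\int_{\mathbb R}g(X_{u-},Y_{u-},z)\,\wp(du,dz),$$ that is, an $\{\mathcal F_t\}$-adapted process, almost surely with right-continuous paths having left limits, such that almost surely the integrals exist and both equations hold for all $t\ge0$. \textbf{Theorem.} The augmented process $Z_t=(X_t,Y_t)$ is a Markov process. Precisely: \begin{enumerate} \item If for every $t\ge 0$ the restriction of $\wp$ to $(t,\infty)\times\mathbb R$ is independent of $\mathcal F_t$ (that is, $\wp$ is a Poisson random measure relative to $\{\mathcal F_t\}$), then for all $0\le s<t$ and all Borel sets $A\subseteq\chi\times[0,\infty)$, $$P[Z_t\in A\mid\mathcal F_s]=P[Z_t\in A\mid Z_s]\quad\text{a.s.}$$ \item If the initial value $Z_0=(X_0,Y_0)$ is independent of $\wp$, then for all $0\le s<t$ and all Borel sets $A\subseteq\chi\times[0,\infty)$, $$P[Z_t\in A\mid Z_u,\ u\le s]=P[Z_t\in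 A\mid Z_s]\quad\text{a.s.}$$ \end{enumerate} -/

import Mathlib

open MeasureTheory ProbabilityTheory Set Filter Topology
open scoped NNReal ENNReal

noncomputable section

/-- The real number attached to a state: the `k` elements of `Fin k` stand for
`1, 2, …, k`. -/
def stateVal {k : ℕ} (i : Fin k) : ℝ := (i : ℝ) + 1

/-- The assumptions on the transition rates `lam i j y`, `i ≠ j`, `y ∈ (0, ∞)`. Nothing is required
of the diagonal or of the values at `y ≤ 0`, which are never used. -/
structure IsRateFunction {k : ℕ} (lam : Fin k → Fin k → ℝ → ℝ) : Prop where
  measurable : ∀ i j, i ≠ j → Measurable ((Ioi (0 : ℝ)).domRestrict (lam i j))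
  nonneg : ∀ i j, i ≠ j → ∀ y : ℝ, 0 < y → 0 ≤ lam i j y
  bddAbove : ∀ i, BddAbove ((fun y : ℝ => ∑ j with j ≠ i, lam i j y) '' Ioi 0)
  tendsto_integral : ∀ i,
    Tendsto (fun y : ℝ => ∫ v in (0 : ℝ)..y, ∑ j with j ≠ i, lam i j v) atTop atTop

/-- The left end point of the interval of the pair `(i, j)`: the total length of the intervals of all
off-diagonal pairs that precede `(i, j)` lexicographically. -/
def intervalStart {k : ℕ} (lam : Fin k → Fin k → ℝ → ℝ) (i j : Fin k) (y : ℝ) : ℝ :=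
  ∑ p : Fin k × Fin k with p.1 ≠ p.2 ∧ (p.1 < i ∨ (p.1 = i ∧ p.2 < j)), lam p.1 p.2 y

/-- The intervals `Λ_{ij}(y)`, for `y > 0`: consecutive, starting at `0`, left-closed and right-open,
of length `lam i j y`. (For `y = 0`, where the rates are not defined, the empty set.) -/
def rateInterval {k : ℕ} (lam : Fin k → Fin k → ℝ → ℝ) (i j : Fin k) (y : ℝ≥0) : Set ℝ :=
  if 0 < y then Ico (intervalStart lam i j y) (intervalStart lam i j y + lam i j y) else ∅

/-- `h(i, y, z) = ∑_{j ≠ i} (j - i) 1_{Λ_{ij}(y)}(z)`. -/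
def jumpX {k : ℕ} (lam : Fin k → Fin k → ℝ → ℝ) (i : Fin k) (y : ℝ≥0) (z : ℝ) : ℝ :=
  ∑ j with j ≠ i, (stateVal j - stateVal i) * (rateInterval lam i j y).indicator 1 z

/-- `g(i, y, z) = y ∑_{j ≠ i} 1_{Λ_{ij}(y)}(z)`. -/
def jumpY {k : ℕ} (lam : Fin k → Fin k → ℝ → ℝ) (i : Fin k) (y : ℝ≥0) (z : ℝ) : ℝ :=
  (y : ℝ) * ∑ j with j ≠ i, (rateInterval lam i j y).indicator 1 z

/-- The intensity `du × dz` on `[0, ∞) × ℝ`. -/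
def intensity : Measure (ℝ≥0 × ℝ) :=
  ((volume : Measure ℝ).comap ((↑) : ℝ≥0 → ℝ)).prod (volume : Measure ℝ)

/-- `N` is a Poisson random measure with mean measure `μ` on the probability space `(Ω, P)`. The
measurable structure on `Measure E` is generated by the evaluations `m ↦ m A`. -/
structure IsPoissonRandomMeasure {Ω E : Type*} [MeasurableSpace Ω] [MeasurableSpace E]
    (N : Ω → Measure E) (μ : Measure E) (P : Measure Ω) : Prop where
  measurable : Measurable N
  integer_valued : ∀ ω, ∀ A, MeasurableSet A → ∃ n : ℕ∞, N ω A = (n : ℝ≥0∞)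
  law_of_finite : ∀ A, MeasurableSet A → μ A ≠ ∞ → ∀ n : ℕ,
    P {ω | N ω A = n} =
      ENNReal.ofReal (Real.exp (-(μ A).toReal) * (μ A).toReal ^ n / n.factorial)
  law_of_infinite : ∀ A, MeasurableSet A → μ A = ∞ → ∀ n : ℕ, P {ω | N ω A = n} = 0
  indep : ∀ (m : ℕ) (A : Fin m → Set E), (∀ i, MeasurableSet (A i)) →
    Pairwise (fun i j => Disjoint (A i) (A j)) → iIndepFun (fun i ω => N ω (A i)) P

/-- The process of measures `t ↦ N((0, t] × dz)` is adapted to the filtration `ℱ`. -/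
def IsAdaptedRandomMeasure {Ω : Type*} {mΩ : MeasurableSpace Ω}
    (N : Ω → Measure (ℝ≥0 × ℝ)) (ℱ : Filtration ℝ≥0 mΩ) : Prop :=
  ∀ t : ℝ≥0, ∀ B : Set ℝ, MeasurableSet B → Measurable[ℱ t] (fun ω => N ω (Ioc 0 t ×ˢ B))

/-- For every `t`, the restriction of `N` to `(t, ∞) × ℝ` is independent of `ℱ t`. -/
def HasFutureIndepOf {Ω : Type*} {mΩ : MeasurableSpace Ω}
    (N : Ω → Measure (ℝ≥0 × ℝ)) (ℱ : Filtration ℝ≥0 mΩ) (P : Measure Ω) : Prop :=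
  ∀ t : ℝ≥0, Indep (ℱ t)
    (MeasurableSpace.comap (fun ω => (N ω).restrict (Ioi t ×ˢ univ)) inferInstance) P

/-- A path is right-continuous with left limits. -/
def IsRCLL {S : Type*} [TopologicalSpace S] (x : ℝ≥0 → S) : Prop :=
  ∀ t, ContinuousWithinAt x (Ici t) t ∧ ∃ l, Tendsto x (𝓝[<] t) (𝓝 l)

/-- `(X, Y)` is an `ℱ`-adapted solution, with right-continuous paths with left limits, of
`X_t = X_0 + ∫_{(0,t]} ∫_ℝ h(X_{u-}, Y_{u-}, z) N(du, dz)`,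
`Y_t = Y_0 + t - ∫_{(0,t]} ∫_ℝ g(X_{u-}, Y_{u-}, z) N(du, dz)`;
almost surely the integrals exist and the equations hold for all `t`. -/
structure IsStrongSolution {Ω : Type*} {mΩ : MeasurableSpace Ω} {k : ℕ}
    (lam : Fin k → Fin k → ℝ → ℝ) (N : Ω → Measure (ℝ≥0 × ℝ)) (ℱ : Filtration ℝ≥0 mΩ)
    (P : Measure Ω) (X : ℝ≥0 → Ω → Fin k) (Y : ℝ≥0 → Ω → ℝ≥0) : Prop where
  adapted_fst : ∀ t, Measurable[ℱ t] (X t)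
  adapted_snd : ∀ t, Measurable[ℱ t] (Y t)
  rcll_fst : ∀ᵐ ω ∂P, IsRCLL (fun t => X t ω)
  rcll_snd : ∀ᵐ ω ∂P, IsRCLL (fun t => Y t ω)
  eq_fst : ∀ᵐ ω ∂P, ∀ t : ℝ≥0,
    IntegrableOn (fun p : ℝ≥0 × ℝ => jumpX lam (Function.leftLim (fun u => X u ω) p.1)
      (Function.leftLim (fun u => Y u ω) p.1) p.2) (Ioc 0 t ×ˢ univ) (N ω) ∧
    stateVal (X t ω) = stateVal (X 0 ω) +
      ∫ p in Ioc 0 t ×ˢ univ, jumpX lam (Function.leftLim (fun u => X u ω) p.1)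
        (Function.leftLim (fun u => Y u ω) p.1) p.2 ∂(N ω)
  eq_snd : ∀ᵐ ω ∂P, ∀ t : ℝ≥0,
    IntegrableOn (fun p : ℝ≥0 × ℝ => jumpY lam (Function.leftLim (fun u => X u ω) p.1)
      (Function.leftLim (fun u => Y u ω) p.1) p.2) (Ioc 0 t ×ˢ univ) (N ω) ∧
    (Y t ω : ℝ) = (Y 0 ω : ℝ) + (t : ℝ) -
      ∫ p in Ioc 0 t ×ˢ univ, jumpY lam (Function.leftLim (fun u => X u ω) p.1)
        (Function.leftLim (fun u => Y u ω) p.1) p.2 ∂(N ω)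

/-- The augmented process `Z_t = (X_t, Y_t)`. -/
def augmented {Ω : Type*} {k : ℕ} (X : ℝ≥0 → Ω → Fin k) (Y : ℝ≥0 → Ω → ℝ≥0) :
    ℝ≥0 → Ω → Fin k × ℝ≥0 := fun t ω => (X t ω, Y t ω)

theorem IsStrongSolution.measurable_augmented {Ω : Type*} {mΩ : MeasurableSpace Ω} {k : ℕ}
    {lam : Fin k → Fin k → ℝ → ℝ} {N : Ω → Measure (ℝ≥0 × ℝ)} {ℱ : Filtration ℝ≥0 mΩ}
    {P : Measure Ω} {X : ℝ≥0 → Ω → Fin k} {Y : ℝ≥0 → Ω → ℝ≥0}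
    (h : IsStrongSolution lam N ℱ P X Y) (t : ℝ≥0) : Measurable (augmented X Y t) :=
  ((h.adapted_fst t).mono (ℱ.le t) le_rfl).prodMk ((h.adapted_snd t).mono (ℱ.le t) le_rfl)

/-- The filtration generated by a process, `t ↦ σ(Z_u : u ≤ t)`. -/
def generatedFiltration {Ω S : Type*} {mΩ : MeasurableSpace Ω} [mS : MeasurableSpace S]
    (Z : ℝ≥0 → Ω → S) (hZ : ∀ t, Measurable (Z t)) : Filtration ℝ≥0 mΩ where
  seq t := ⨆ u, ⨆ _ : u ≤ t, MeasurableSpace.comap (Z u) mS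
  mono' _ _ hst := iSup₂_le fun u hu => le_iSup₂_of_le u (hu.trans hst) le_rfl
  le' _ := iSup₂_le fun u _ => (hZ u).comap_le

/-- `Z` is a Markov process with respect to `ℱ`: it is adapted, and
`P[Z_t ∈ A | ℱ_s] = P[Z_t ∈ A | Z_s]` almost surely, for all `s < t` and measurable `A`. -/
structure IsMarkovProcess {Ω S : Type*} {mΩ : MeasurableSpace Ω} [mS : MeasurableSpace S]
    (Z : ℝ≥0 → Ω → S) (ℱ : Filtration ℝ≥0 mΩ) (P : Measure Ω) : Prop where
  adapted : ∀ t, Measurable[ℱ t] (Z t)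
  markov : ∀ s t : ℝ≥0, s < t → ∀ A : Set S, MeasurableSet A →
    P⟦Z t ⁻¹' A | ℱ s⟧ =ᵐ[P] P⟦Z t ⁻¹' A | MeasurableSpace.comap (Z s) mS⟧

end

/-! The total length of the rate intervals is bounded, so `h` and `g` vanish for `z` outside some
`[0, C)`. On `(s, t]` the solution therefore sees only the points of `N` in `(s, t] × [0, C)`,
almost surely finitely many, and `Z_t` is a functional of `Z_s` and of these points. The rates are
merely measurable, so no contraction is available. Instead, the `m`-th Picard iterate equals the
left-limit path at `v` once fewer than `m` points lie in `(s, v)` (`SolvesOn.picardIter_eq`), and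
the iterates are jointly measurable in the initial value and the driving measure
(`IsRateFunction.exists_measurable_solution`).

Hence `{Z_t ∈ A}` is, up to a null set, an event of `σ(Z_s) ⊔ H`, where `H` is generated by `N` on
`(s, t] × ℝ`. If `H` is independent of the past, conditioning on the past reduces to conditioning on
`Z_s` (`condExp_indicator_eq_of_indep`). When only `Z_0` is assumed independent of `N`, the same
functional expresses each `Z_u`, `u ≤ s`, through `Z_0` and `N` on `(0, s]`. Since `N` has
independent restrictions to disjoint sets, the history of `Z` up to `s` is independent of the future
of `N`. -/

noncomputable section

/-! ### Boundedness and measurability of the rate intervals -/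

namespace IsRateFunction

variable {k : ℕ} {lam : Fin k → Fin k → ℝ → ℝ}

/-- The total length of all the rate intervals is bounded. -/
theorem exists_forall_sum_le (h : IsRateFunction lam) :
    ∃ C : ℝ, ∀ y : ℝ, 0 < y → ∑ p : Fin k × Fin k with p.1 ≠ p.2, lam p.1 p.2 y ≤ C := by
  choose B hB using h.bddAbove
  refine ⟨∑ i, B i, fun y hy => ?_⟩
  have : ∑ p : Fin k × Fin k with p.1 ≠ p.2, lam p.1 p.2 y
      = ∑ i, ∑ j with j ≠ i, lam i j y := by
    rw [Finset.sum_filter, Fintype.sum_prod_type]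
    simp_rw [Finset.sum_filter, ne_comm]
  rw [this]
  exact Finset.sum_le_sum fun i _ => hB i (mem_image_of_mem _ hy)

theorem intervalStart_nonneg (h : IsRateFunction lam) (i j : Fin k) {y : ℝ} (hy : 0 < y) :
    0 ≤ intervalStart lam i j y :=
  Finset.sum_nonneg fun _ hp => h.nonneg _ _ (Finset.mem_filter.1 hp).2.1 y hy

theorem intervalStart_add_le (h : IsRateFunction lam) {i j : Fin k} (hij : i ≠ j) {y : ℝ}
    (hy : 0 < y) : intervalStart lam i j y + lam i j y ≤
      ∑ p : Fin k × Fin k with p.1 ≠ p.2, lam p.1 p.2 y := by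
  classical
  have hnot : (i, j) ∉ ({p : Fin k × Fin k | p.1 ≠ p.2 ∧ (p.1 < i ∨ (p.1 = i ∧ p.2 < j))} :
      Finset _) := by simp
  rw [intervalStart, add_comm,
    ← Finset.sum_insert (f := fun p : Fin k × Fin k => lam p.1 p.2 y) hnot]
  refine Finset.sum_le_sum_of_subset_of_nonneg (fun _ hp => ?_) fun p hp _ => ?_
  · rcases Finset.mem_insert.1 hp with rfl | hp
    · simpa using hij
    · simpa using (Finset.mem_filter.1 hp).2.1
  · exact h.nonneg _ _ (Finset.mem_filter.1 hp).2 y hy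

theorem exists_rateInterval_subset (h : IsRateFunction lam) :
    ∃ C : ℝ, ∀ i j, i ≠ j → ∀ y, rateInterval lam i j y ⊆ Ico 0 C := by
  obtain ⟨C, hC⟩ := h.exists_forall_sum_le
  refine ⟨C, fun i j hij y => ?_⟩
  unfold rateInterval
  split_ifs with hy
  · have hy' : (0 : ℝ) < y := hy
    exact Ico_subset_Ico (h.intervalStart_nonneg i j hy')
      ((h.intervalStart_add_le hij hy').trans (hC _ hy'))
  · exact empty_subset _

theorem exists_jump_eq_zero (h : IsRateFunction lam) :
    ∃ C : ℝ, ∀ i y z, z ∉ Ico 0 C → jumpX lam i y z = 0 ∧ jumpY lam i y z = 0 := by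
  obtain ⟨C, hC⟩ := h.exists_rateInterval_subset
  refine ⟨C, fun i y z hz => ?_⟩
  have h0 : ∀ j ∈ ({j | j ≠ i} : Finset (Fin k)),
      (rateInterval lam i j y).indicator (1 : ℝ → ℝ) z = 0 := fun j hj =>
    indicator_of_notMem (fun hz' => hz (hC i j (Finset.mem_filter.1 hj).2.symm y hz')) _
  constructor
  · exact Finset.sum_eq_zero fun j hj => by rw [h0 j hj, mul_zero]
  · rw [jumpY, Finset.sum_eq_zero h0, mul_zero]

/-- Measurability is assumed on `(0, ∞)` only; extension by zero yields a function measurable on all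
of `ℝ`. -/
theorem measurable_indicator (h : IsRateFunction lam) {i j : Fin k} (hij : i ≠ j) :
    Measurable ((Ioi (0 : ℝ)).indicator (lam i j)) := by
  refine measurable_of_restrict_of_restrict_compl (s := Ioi (0 : ℝ)) measurableSet_Ioi ?_ ?_
  · convert h.measurable i j hij using 1
    funext y
    simp [domRestrict_apply]
  · convert measurable_const (a := (0 : ℝ)) using 1
    funext y
    simp only [domRestrict_apply, indicator_of_notMem y.2]

theorem measurableSet_rateInterval (h : IsRateFunction lam) {i j : Fin k} (hij : i ≠ j) :
    MeasurableSet {p : ℝ≥0 × ℝ | p.2 ∈ rateInterval lam i j p.1} := by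
  set L : Fin k → Fin k → ℝ → ℝ := fun i j => (Ioi (0 : ℝ)).indicator (lam i j)
  have hstart : Measurable fun y : ℝ≥0 => intervalStart L i j y := by
    refine Finset.measurable_fun_sum _ fun p hp => ?_
    exact (h.measurable_indicator (Finset.mem_filter.1 hp).2.1).comp measurable_subtype_coe
  have hlam : Measurable fun y : ℝ≥0 => L i j y :=
    (h.measurable_indicator hij).comp measurable_subtype_coe
  have heq : {p : ℝ≥0 × ℝ | p.2 ∈ rateInterval lam i j p.1} =
      {p | 0 < p.1} ∩ ({p | intervalStart L i j p.1 ≤ p.2} ∩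
        {p | p.2 < intervalStart L i j p.1 + L i j p.1}) := by
    ext ⟨y, z⟩
    by_cases hy : 0 < y
    · have hy' : (y : ℝ) ∈ Ioi (0 : ℝ) := hy
      have e : intervalStart L i j y = intervalStart lam i j y := by
        simp [intervalStart, L, indicator_of_mem hy']
      simp [rateInterval, hy, e, L]
    · simp [rateInterval, hy]
  rw [heq]
  exact (measurableSet_lt measurable_const measurable_fst).inter
    ((measurableSet_le (hstart.comp measurable_fst) measurable_snd).inter
      (measurableSet_lt measurable_snd
        ((hstart.comp measurable_fst).add (hlam.comp measurable_fst))))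

theorem measurable_rateInterval_indicator (h : IsRateFunction lam) {i j : Fin k} (hij : i ≠ j) :
    Measurable fun p : ℝ≥0 × ℝ => (rateInterval lam i j p.1).indicator (1 : ℝ → ℝ) p.2 :=
  (measurable_one (α := ℝ) (β := ℝ≥0 × ℝ)).indicator (h.measurableSet_rateInterval hij)

theorem measurable_jumpX (h : IsRateFunction lam) :
    Measurable fun p : Fin k × ℝ≥0 × ℝ => jumpX lam p.1 p.2.1 p.2.2 := by
  refine measurable_from_prod_countable_right fun i => ?_
  simp only [jumpX]
  refine Finset.measurable_fun_sum _ fun j hj => Measurable.const_mul ?_ _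
  exact h.measurable_rateInterval_indicator (Ne.symm (Finset.mem_filter.1 hj).2)

theorem measurable_jumpY (h : IsRateFunction lam) :
    Measurable fun p : Fin k × ℝ≥0 × ℝ => jumpY lam p.1 p.2.1 p.2.2 := by
  refine measurable_from_prod_countable_right fun i => ?_
  simp only [jumpY]
  refine (measurable_subtype_coe.comp measurable_fst).mul
    (Finset.measurable_fun_sum _ fun j hj => ?_)
  exact h.measurable_rateInterval_indicator (Ne.symm (Finset.mem_filter.1 hj).2)

end IsRateFunction

/-- The state with a given value, `i₀` if there is none. -/
def stateOf {k : ℕ} (i₀ : Fin k) (x : ℝ) : Fin k :=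
  -- The subtraction undoes the shift by one in `stateVal`. The fallback `i₀` makes the map total,
  -- so that Picard iterates are states even where they solve nothing.
  if h : ⌊x⌋₊ - 1 < k then ⟨⌊x⌋₊ - 1, h⟩ else i₀

@[simp]
theorem stateOf_stateVal {k : ℕ} (i₀ i : Fin k) : stateOf i₀ (stateVal i) = i := by
  have : ⌊stateVal i⌋₊ = (i : ℕ) + 1 := by
    have : stateVal i = (((i : ℕ) + 1 : ℕ) : ℝ) := by simp [stateVal]
    rw [this, Nat.floor_natCast]
  simp [stateOf, this]

theorem measurable_stateOf {k : ℕ} : Measurable fun p : Fin k × ℝ => stateOf p.1 p.2 := by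
  refine measurable_from_prod_countable_right fun i => ?_
  exact (measurable_from_nat (f := fun n : ℕ => if h : n - 1 < k then ⟨n - 1, h⟩ else i)).comp
    (Nat.measurable_floor (R := ℝ))

end

/-! ### Picard iteration and its measurability -/

noncomputable section

variable {k : ℕ} {lam : Fin k → Fin k → ℝ → ℝ}

/-- The right-hand sides of the equations of a solution started from `z` at time `s`, evaluated at
time `v` along the path `φ`, with the integrals taken over times in `A`. -/
def solutionStep (lam : Fin k → Fin k → ℝ → ℝ) (ν : Measure (ℝ≥0 × ℝ)) (s : ℝ≥0)
    (z : Fin k × ℝ≥0) (φ : ℝ≥0 → Fin k × ℝ≥0) (A : Set ℝ≥0) (v : ℝ≥0) : Fin k × ℝ≥0 :=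
  (stateOf z.1 (stateVal z.1 + ∫ p in A ×ˢ univ, jumpX lam (φ p.1).1 (φ p.1).2 p.2 ∂ν),
    ((z.2 : ℝ) + ((v : ℝ) - s) -
      ∫ p in A ×ˢ univ, jumpY lam (φ p.1).1 (φ p.1).2 p.2 ∂ν).toNNReal)

/-- The Picard iterates for the left-limit path of a solution started from `z` at time `s`. -/
def picardIter (lam : Fin k → Fin k → ℝ → ℝ) (ν : Measure (ℝ≥0 × ℝ)) (s : ℝ≥0)
    (z : Fin k × ℝ≥0) : ℕ → ℝ≥0 → Fin k × ℝ≥0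
  | 0 => fun _ => z
  | m + 1 => fun v => solutionStep lam ν s z (picardIter lam ν s z m) (Ioo s v) v

/-- The path enters only through integrals over `A ×ˢ univ`, so only its values at `ν`-almost every
point there matter. -/
theorem solutionStep_congr {ν : Measure (ℝ≥0 × ℝ)} {s : ℝ≥0} {z : Fin k × ℝ≥0}
    {φ ψ : ℝ≥0 → Fin k × ℝ≥0} {A : Set ℝ≥0} (v : ℝ≥0)
    (h : ∀ᵐ p ∂ν.restrict (A ×ˢ univ), φ p.1 = ψ p.1) :
    solutionStep lam ν s z φ A v = solutionStep lam ν s z ψ A v := by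
  unfold solutionStep
  congr 3
  · exact integral_congr_ae (h.mono fun p hp => by simp only [hp])
  · exact integral_congr_ae (h.mono fun p hp => by simp only [hp])

section Measurability

variable {α : Type*} [MeasurableSpace α]

theorem measurable_setIntegral_kernel {β : Type*} [MeasurableSpace β] (κ : Kernel α (ℝ≥0 × ℝ))
    [IsSFiniteKernel κ] {A : β → Set ℝ≥0} (hA : MeasurableSet {q : β × ℝ≥0 | q.2 ∈ A q.1})
    {f : α × ℝ≥0 × ℝ → ℝ} (hf : Measurable f) :
    Measurable fun p : α × β => ∫ q in A p.2 ×ˢ univ, f (p.1, q) ∂(κ p.1) := by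
  have hAm : ∀ b, MeasurableSet (A b) := fun b => measurable_prodMk_left hA
  -- The varying domain of integration is moved into the integrand as an indicator, leaving a
  -- parametrised integral against a kernel.
  have h1 : Measurable fun x : (α × β) × (ℝ≥0 × ℝ) =>
      ({q : β × ℝ≥0 | q.2 ∈ A q.1}.indicator 1 (x.1.2, x.2.1) : ℝ) * f (x.1.1, x.2) := by
    refine Measurable.mul ?_ ?_
    · exact (measurable_one.indicator hA).comp (by fun_prop)
    · exact hf.comp (by fun_prop)
  have h2 := (h1.stronglyMeasurable.integral_kernel_prod_right' (κ := κ.prodMkRight β)).measurable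
  convert h2 using 1
  funext p
  rw [Kernel.prodMkRight_apply, ← integral_indicator ((hAm p.2).prod MeasurableSet.univ)]
  congr 1
  funext q
  by_cases hq : q.1 ∈ A p.2 <;> simp [indicator, hq]

theorem IsRateFunction.measurable_solutionStep (h : IsRateFunction lam)
    (κ : Kernel α (ℝ≥0 × ℝ)) [IsSFiniteKernel κ] (s : ℝ≥0) {z : α → Fin k × ℝ≥0}
    (hz : Measurable z) {φ : α → ℝ≥0 → Fin k × ℝ≥0}
    (hφ : Measurable fun p : α × ℝ≥0 => φ p.1 p.2) {A : ℝ≥0 → Set ℝ≥0}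
    (hA : MeasurableSet {q : ℝ≥0 × ℝ≥0 | q.2 ∈ A q.1}) :
    Measurable fun p : α × ℝ≥0 => solutionStep lam (κ p.1) s (z p.1) (φ p.1) (A p.2) p.2 := by
  have hφ' : Measurable fun x : α × ℝ≥0 × ℝ => φ x.1 x.2.1 :=
    hφ.comp (measurable_fst.prodMk (measurable_fst.comp measurable_snd))
  have harg : Measurable fun x : α × ℝ≥0 × ℝ =>
      ((φ x.1 x.2.1).1, ((φ x.1 x.2.1).2, x.2.2)) :=
    (measurable_fst.comp hφ').prodMk
      ((measurable_snd.comp hφ').prodMk (measurable_snd.comp measurable_snd))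
  have hX := h.measurable_jumpX.comp harg
  have hY := h.measurable_jumpY.comp harg
  simp only [Function.comp_def] at hX hY
  have hz1 : Measurable fun p : α × ℝ≥0 => (z p.1).1 := measurable_fst.comp (hz.comp measurable_fst)
  have hz2 : Measurable fun p : α × ℝ≥0 => (z p.1).2 := measurable_snd.comp (hz.comp measurable_fst)
  have hIX := measurable_setIntegral_kernel κ hA hX
  have hIY := measurable_setIntegral_kernel κ hA hY
  have hval : Measurable fun p : α × ℝ≥0 => stateVal (z p.1).1 :=
    (measurable_of_finite stateVal).comp hz1
  have h2 : Measurable fun p : α × ℝ≥0 => ((z p.1).2 : ℝ) + ((p.2 : ℝ) - s) := by fun_prop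
  unfold solutionStep
  exact (measurable_stateOf.comp (hz1.prodMk (hval.add hIX))).prodMk (h2.sub hIY).real_toNNReal

theorem measurableSet_prod_mem_Ioo (s : ℝ≥0) :
    MeasurableSet {q : ℝ≥0 × ℝ≥0 | q.2 ∈ Ioo s q.1} :=
  (measurableSet_lt (f := fun _ : ℝ≥0 × ℝ≥0 => s) (g := fun q => q.2)
    measurable_const measurable_snd).inter
    (measurableSet_lt (f := fun q : ℝ≥0 × ℝ≥0 => q.2) (g := fun q => q.1)
      measurable_snd measurable_fst)

theorem IsRateFunction.measurable_picardIter (h : IsRateFunction lam)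
    (κ : Kernel α (ℝ≥0 × ℝ)) [IsSFiniteKernel κ] (s : ℝ≥0) {z : α → Fin k × ℝ≥0}
    (hz : Measurable z) (m : ℕ) :
    Measurable fun p : α × ℝ≥0 => picardIter lam (κ p.1) s (z p.1) m p.2 := by
  induction m with
  | zero => exact hz.comp measurable_fst
  | succ m ih =>
    exact h.measurable_solutionStep κ s hz (φ := fun a => picardIter lam (κ a) s (z a) m) ih
      (A := fun v => Ioo s v) (measurableSet_prod_mem_Ioo s)

end Measurability

/-! ### Pathwise determination of solutions by finitely many points -/

/-- The path `(x, y)` solves the equations driven by `ν` on the time interval `[s, t]`. -/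
structure SolvesOn (lam : Fin k → Fin k → ℝ → ℝ) (ν : Measure (ℝ≥0 × ℝ)) (s t : ℝ≥0)
    (x : ℝ≥0 → Fin k) (y : ℝ≥0 → ℝ≥0) : Prop where
  integrable_fst : Integrable (fun p : ℝ≥0 × ℝ =>
    jumpX lam (Function.leftLim x p.1) (Function.leftLim y p.1) p.2) ν
  integrable_snd : Integrable (fun p : ℝ≥0 × ℝ =>
    jumpY lam (Function.leftLim x p.1) (Function.leftLim y p.1) p.2) ν
  eq_fst : ∀ u ∈ Icc s t, stateVal (x u) = stateVal (x s) + ∫ p in Ioc s u ×ˢ univ,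
    jumpX lam (Function.leftLim x p.1) (Function.leftLim y p.1) p.2 ∂ν
  eq_snd : ∀ u ∈ Icc s t, (y u : ℝ) = (y s : ℝ) + ((u : ℝ) - s) - ∫ p in Ioc s u ×ˢ univ,
    jumpY lam (Function.leftLim x p.1) (Function.leftLim y p.1) p.2 ∂ν

/-- Dominated convergence: as `u ↑ v`, the indicator of `(s, u]` at each point eventually equals
that of `(s, v)`. This is why the Picard iterates integrate over open intervals. -/
theorem tendsto_setIntegral_Ioc_left {ν : Measure (ℝ≥0 × ℝ)} {F : ℝ≥0 × ℝ → ℝ}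
    (hF : Integrable F ν) (s v : ℝ≥0) :
    Tendsto (fun u => ∫ p in Ioc s u ×ˢ univ, F p ∂ν) (𝓝[<] v)
      (𝓝 (∫ p in Ioo s v ×ˢ univ, F p ∂ν)) := by
  have hm : ∀ u, MeasurableSet (Ioc s u ×ˢ (univ : Set ℝ)) := fun u =>
    measurableSet_Ioc.prod MeasurableSet.univ
  have hm' : MeasurableSet (Ioo s v ×ˢ (univ : Set ℝ)) := measurableSet_Ioo.prod MeasurableSet.univ
  simp_rw [← integral_indicator hm']
  simp_rw [fun u => (integral_indicator (μ := ν) (f := F) (hm u)).symm]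
  refine tendsto_integral_filter_of_dominated_convergence (fun p => ‖F p‖)
    (Eventually.of_forall fun u => hF.aestronglyMeasurable.indicator (hm u))
    (Eventually.of_forall fun u => ae_of_all _ fun p => norm_indicator_le_norm_self _ _)
    hF.norm (ae_of_all _ fun p => ?_)
  refine tendsto_const_nhds.congr' ?_
  rcases lt_or_ge p.1 v with hp | hp
  · filter_upwards [Ioo_mem_nhdsLT hp] with u hu
    simp only [indicator, mem_prod, mem_Ioo, mem_Ioc, mem_univ, and_true, hp, hu.1.le]
  · filter_upwards [self_mem_nhdsWithin] with u hu
    have h1 : ¬ p.1 < v := hp.not_gt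
    have h2 : ¬ p.1 ≤ u := (lt_of_lt_of_le hu hp).not_ge
    simp only [indicator, mem_prod, mem_Ioo, mem_Ioc, mem_univ, and_true, h1, h2, and_false]

theorem IsRCLL.tendsto_leftLim {S : Type*} [TopologicalSpace S] {x : ℝ≥0 → S} (hx : IsRCLL x)
    (v : ℝ≥0) : Tendsto x (𝓝[<] v) (𝓝 (Function.leftLim x v)) :=
  tendsto_leftLim_of_tendsto (hx v).2

/-- Letting `u ↑ v` in the equations shows that the left-limit path is a fixed point of the Picard
step. -/
theorem SolvesOn.solutionStep_leftLim {ν : Measure (ℝ≥0 × ℝ)} {s t : ℝ≥0}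
    {x : ℝ≥0 → Fin k} {y : ℝ≥0 → ℝ≥0} (h : SolvesOn lam ν s t x y) (hx : IsRCLL x)
    (hy : IsRCLL y) {v : ℝ≥0} (hv : v ∈ Ioc s t) :
    solutionStep lam ν s (x s, y s) (fun u => (Function.leftLim x u, Function.leftLim y u))
      (Ioo s v) v = (Function.leftLim x v, Function.leftLim y v) := by
  have hne : (𝓝[<] v).NeBot := nhdsLT_neBot_of_exists_lt ⟨s, hv.1⟩
  have hmem : ∀ᶠ u in 𝓝[<] v, u ∈ Icc s t := by
    filter_upwards [Ioo_mem_nhdsLT hv.1] with u hu using ⟨hu.1.le, hu.2.le.trans hv.2⟩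
  have e1 : stateVal (Function.leftLim x v) = stateVal (x s) + ∫ p in Ioo s v ×ˢ univ,
      jumpX lam (Function.leftLim x p.1) (Function.leftLim y p.1) p.2 ∂ν := by
    have l1 : Tendsto (fun u => stateVal (x u)) (𝓝[<] v) (𝓝 (stateVal (Function.leftLim x v))) :=
      (continuous_of_discreteTopology.tendsto _).comp (hx.tendsto_leftLim v)
    refine tendsto_nhds_unique l1
      (((tendsto_setIntegral_Ioc_left h.integrable_fst s v).const_add _).congr' ?_)
    filter_upwards [hmem] with u hu using (h.eq_fst u hu).symm
  have e2 : ((Function.leftLim y v : ℝ≥0) : ℝ) = (y s : ℝ) + ((v : ℝ) - s) - ∫ p in Ioo s v ×ˢ univ,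
      jumpY lam (Function.leftLim x p.1) (Function.leftLim y p.1) p.2 ∂ν := by
    have l1 : Tendsto (fun u => (y u : ℝ)) (𝓝[<] v) (𝓝 ((Function.leftLim y v : ℝ≥0) : ℝ)) :=
      (NNReal.continuous_coe.tendsto _).comp (hy.tendsto_leftLim v)
    have l2 : Tendsto (fun u : ℝ≥0 => (y s : ℝ) + ((u : ℝ) - s)) (𝓝[<] v)
        (𝓝 ((y s : ℝ) + ((v : ℝ) - s))) :=
      (Continuous.tendsto (by fun_prop) v).mono_left nhdsWithin_le_nhds
    refine tendsto_nhds_unique l1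
      ((l2.sub (tendsto_setIntegral_Ioc_left h.integrable_snd s v)).congr' ?_)
    filter_upwards [hmem] with u hu using (h.eq_snd u hu).symm
  simp only [solutionStep, ← e1, ← e2, stateOf_stateVal, Real.toNNReal_coe]

theorem SolvesOn.solutionStep_right {ν : Measure (ℝ≥0 × ℝ)} {s t : ℝ≥0}
    {x : ℝ≥0 → Fin k} {y : ℝ≥0 → ℝ≥0} (h : SolvesOn lam ν s t x y) (hst : s ≤ t) :
    solutionStep lam ν s (x s, y s) (fun u => (Function.leftLim x u, Function.leftLim y u))
      (Ioc s t) t = (x t, y t) := by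
  simp only [solutionStep, ← h.eq_fst t ⟨hst, le_rfl⟩, ← h.eq_snd t ⟨hst, le_rfl⟩,
    stateOf_stateVal, Real.toNNReal_coe]

/-- An integer-valued measure with at most `m` points over `(s, v)` charges only times before which
it has fewer than `m` points. -/
theorem ae_measure_Ioo_lt {ν : Measure (ℝ≥0 × ℝ)}
    (hν : ∀ A, MeasurableSet A → ∃ n : ℕ∞, ν A = (n : ℝ≥0∞)) {s v : ℝ≥0} {m : ℕ}
    (hm : ν (Ioo s v ×ˢ univ) < ((m + 1 : ℕ) : ℝ≥0∞)) :
    ∀ᵐ p ∂ν.restrict (Ioo s v ×ˢ univ), ν (Ioo s p.1 ×ˢ univ) < (m : ℝ≥0∞) := by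
  have hmeas : ∀ a b : ℝ≥0, MeasurableSet (Ioo a b ×ˢ (univ : Set ℝ)) := fun a b =>
    measurableSet_Ioo.prod MeasurableSet.univ
  have hle : ν (Ioo s v ×ˢ univ) ≤ m := by
    obtain ⟨n, hn⟩ := hν _ (hmeas s v)
    rw [hn] at hm ⊢
    have h1 : n < ((m + 1 : ℕ) : ℕ∞) := by exact_mod_cast hm
    have h2 : n ≤ (m : ℕ∞) := by
      rw [Nat.cast_add, Nat.cast_one] at h1
      exact Order.le_of_lt_add_one h1
    exact_mod_cast h2
  -- If `m` points lie before `a`, they exhaust the mass of `(s, v)`, and nothing is left for `[a,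
  -- v)`.
  have hnull : ∀ a ∈ Ioo s v, (m : ℝ≥0∞) ≤ ν (Ioo s a ×ˢ univ) →
      ν (Ico a v ×ˢ univ) = 0 := by
    intro a ha hma
    have hdisj : Disjoint (Ioo s a ×ˢ (univ : Set ℝ)) (Ico a v ×ˢ univ) :=
      Disjoint.set_prod_left (by
        rw [Set.disjoint_left]; exact fun u hu hu' => hu.2.not_ge hu'.1) _ _
    have hadd := measure_union (μ := ν) hdisj (measurableSet_Ico.prod MeasurableSet.univ)
    rw [← union_prod, Ioo_union_Ico_eq_Ioo ha.1 ha.2.le] at hadd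
    have hfin : ν (Ioo s a ×ˢ univ) ≠ ∞ := fun htop => by
      rw [htop, top_add] at hadd
      rw [hadd] at hle
      exact absurd hle (by simp)
    by_contra hne
    have : ν (Ioo s a ×ˢ univ) < ν (Ioo s a ×ˢ univ) + ν (Ico a v ×ˢ univ) :=
      ENNReal.lt_add_right hfin hne
    exact absurd (hle.trans hma) (by rw [hadd]; exact this.not_ge)
  rw [ae_restrict_iff' (hmeas s v), ae_iff]
  -- The exceptional set need not have an earliest time, so nullity is checked locally: near `p` the
  -- set lies in `[q, v)` for an exceptional time `q` before `p` or, if there is none, in `[p, v)`.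
  refine measure_null_of_locally_null _ fun p hp => ?_
  simp only [mem_ofPred_eq, Classical.not_imp, not_lt] at hp
  set V : Set (ℝ≥0 × ℝ) := {p | ¬(p ∈ Ioo s v ×ˢ univ → ν (Ioo s p.1 ×ˢ univ) < (m : ℝ≥0∞))}
    with hV
  have hmemV : ∀ q ∈ V, q.1 ∈ Ioo s v ∧ (m : ℝ≥0∞) ≤ ν (Ioo s q.1 ×ˢ univ) := fun q hq => by
    simp only [hV, mem_ofPred_eq, Classical.not_imp, not_lt] at hq
    exact ⟨hq.1.1, hq.2⟩
  by_cases hmin : ∃ q ∈ V, q.1 < p.1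
  · obtain ⟨q, hqV, hqp⟩ := hmin
    refine ⟨V ∩ Prod.fst ⁻¹' Ioi q.1, inter_mem_nhdsWithin _
      (continuous_fst.continuousAt.preimage_mem_nhds (Ioi_mem_nhds hqp)), ?_⟩
    refine measure_mono_null (fun r hr => ?_) (hnull q.1 (hmemV q hqV).1 (hmemV q hqV).2)
    exact ⟨⟨le_of_lt hr.2, (hmemV r hr.1).1.2⟩, mem_univ _⟩
  · push Not at hmin
    refine ⟨V, self_mem_nhdsWithin, ?_⟩
    refine measure_mono_null (fun r hr => ?_) (hnull p.1 hp.1.1 hp.2)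
    exact ⟨⟨hmin r hr, (hmemV r hr).1.2⟩, mem_univ _⟩

/-- Iterate `m + 1` at `v` integrates iterate `m` over `(s, v)`. Almost every point there has fewer
than `m` points before it, so by induction iterate `m` is already correct at that point. For `m = 0`
the bound on the mass is impossible. -/
theorem SolvesOn.picardIter_eq {ν : Measure (ℝ≥0 × ℝ)}
    (hν : ∀ A, MeasurableSet A → ∃ n : ℕ∞, ν A = (n : ℝ≥0∞)) {s t : ℝ≥0}
    {x : ℝ≥0 → Fin k} {y : ℝ≥0 → ℝ≥0} (h : SolvesOn lam ν s t x y) (hx : IsRCLL x)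
    (hy : IsRCLL y) (m : ℕ) {v : ℝ≥0} (hv : v ∈ Ioc s t)
    (hm : ν (Ioo s v ×ˢ univ) < (m : ℝ≥0∞)) :
    picardIter lam ν s (x s, y s) m v = (Function.leftLim x v, Function.leftLim y v) := by
  induction m generalizing v with
  | zero => simp at hm
  | succ m ih =>
    rw [← h.solutionStep_leftLim hx hy hv]
    refine solutionStep_congr v ?_
    filter_upwards [ae_measure_Ioo_lt hν hm,
      ae_restrict_mem (measurableSet_Ioo.prod MeasurableSet.univ)] with p hp hpm
    exact ih ⟨hpm.1.1, hpm.1.2.le.trans hv.2⟩ hp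

/-- A final step over the half-closed interval includes a possible jump at `t`, turning left limits
into the value at `t`. -/
theorem SolvesOn.solutionStep_picardIter {ν : Measure (ℝ≥0 × ℝ)}
    (hν : ∀ A, MeasurableSet A → ∃ n : ℕ∞, ν A = (n : ℝ≥0∞)) {s t : ℝ≥0} (hst : s ≤ t)
    {x : ℝ≥0 → Fin k} {y : ℝ≥0 → ℝ≥0} (h : SolvesOn lam ν s t x y) (hx : IsRCLL x)
    (hy : IsRCLL y) (m : ℕ) (hm : ν univ < (m : ℝ≥0∞)) :
    solutionStep lam ν s (x s, y s) (picardIter lam ν s (x s, y s) m) (Ioc s t) t =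
      (x t, y t) := by
  rw [← h.solutionStep_right hst]
  refine solutionStep_congr t ?_
  filter_upwards [ae_restrict_mem (measurableSet_Ioc.prod MeasurableSet.univ)] with p hpm
  exact h.picardIter_eq hν hx hy m hpm.1 ((measure_mono (subset_univ _)).trans_lt hm)

end

/-! ### Conditional expectations and independence -/

noncomputable section

section ConditionalIndependence

theorem sup_eq_generateFrom_inter {Ω : Type*} (m m' : MeasurableSpace Ω) :
    m ⊔ m' = MeasurableSpace.generateFrom
      {E | ∃ A B, MeasurableSet[m] A ∧ MeasurableSet[m'] B ∧ A ∩ B = E} := by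
  refine le_antisymm (sup_le (fun A hA => ?_) fun B hB => ?_)
    (MeasurableSpace.generateFrom_le ?_)
  · exact MeasurableSpace.measurableSet_generateFrom
      ⟨A, univ, hA, MeasurableSet.univ, inter_univ _⟩
  · exact MeasurableSpace.measurableSet_generateFrom
      ⟨univ, B, MeasurableSet.univ, hB, univ_inter _⟩
  · rintro _ ⟨A, B, hA, hB, rfl⟩
    exact MeasurableSet.inter ((le_sup_left : m ≤ m ⊔ m') _ hA)
      ((le_sup_right : m' ≤ m ⊔ m') _ hB)

theorem isPiSystem_inter_measurableSet {Ω : Type*} (m m' : MeasurableSpace Ω) :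
    IsPiSystem {E : Set Ω | ∃ A B, MeasurableSet[m] A ∧ MeasurableSet[m'] B ∧ A ∩ B = E} := by
  rintro _ ⟨A, B, hA, hB, rfl⟩ _ ⟨A', B', hA', hB', rfl⟩ -
  exact ⟨A ∩ A', B ∩ B', hA.inter hA', hB.inter hB', inter_inter_inter_comm _ _ _ _⟩

variable {Ω : Type*} {m m' H mΩ : MeasurableSpace Ω} {P : Measure Ω}

theorem setIntegral_inter_of_indep (hm : m ≤ mΩ) (hH : H ≤ mΩ) (h : Indep m H P) {g : Ω → ℝ}
    (hg : StronglyMeasurable[m] g) {A B : Set Ω} (hA : MeasurableSet[m] A)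
    (hB : MeasurableSet[H] B) :
    ∫ ω in A ∩ B, g ω ∂P = (∫ ω in A, g ω ∂P) * P.real B := by
  have hAg : Measurable[m] (A.indicator g) := hg.measurable.indicator hA
  have hB1 : Measurable[H] (B.indicator (fun _ => (1 : ℝ))) := measurable_const.indicator hB
  have hind : IndepFun (A.indicator g) (B.indicator (fun _ => (1 : ℝ))) P :=
    (IndepFun_iff_Indep _ _ _).2
      (indep_of_indep_of_le_left (indep_of_indep_of_le_right h hB1.comap_le) hAg.comap_le)
  have key := hind.integral_fun_mul_eq_mul_integral (hAg.mono hm le_rfl).aestronglyMeasurable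
    (hB1.mono hH le_rfl).aestronglyMeasurable
  rw [integral_indicator (hm _ hA), integral_indicator_const _ (hH _ hB), smul_eq_mul,
    mul_one] at key
  rw [← key, ← integral_indicator ((hm _ hA).inter (hH _ hB))]
  congr 1
  funext ω
  by_cases h1 : ω ∈ A <;> by_cases h2 : ω ∈ B <;> simp [h1, h2]

/-- On `A ∩ B` with `A` in `m'` and `B` in `H`, both integrals factor out `P B`, and the remaining
integrals over `A` agree by definition of conditional expectation. Such sets form a generating
π-system. -/
theorem setIntegral_condExp_of_indep [IsProbabilityMeasure P] (hm : m ≤ mΩ) (hm' : m' ≤ m) (hH : H ≤ mΩ) (h : Indep m H P)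
    {g : Ω → ℝ} (hg : StronglyMeasurable[m] g) (hgi : Integrable g P) {E : Set Ω}
    (hE : MeasurableSet[m' ⊔ H] E) : ∫ ω in E, g ω ∂P = ∫ ω in E, (P[g | m']) ω ∂P := by
  have hle : m' ⊔ H ≤ mΩ := sup_le (hm'.trans hm) hH
  have hci : Integrable (P[g | m']) P := integrable_condExp
  induction E, hE using MeasurableSpace.induction_on_inter
      (sup_eq_generateFrom_inter m' H) (isPiSystem_inter_measurableSet m' H) with
  | empty => simp
  | basic E hE =>
    obtain ⟨A, B, hA, hB, rfl⟩ := hE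
    rw [setIntegral_inter_of_indep hm hH h hg (hm' _ hA) hB,
      setIntegral_inter_of_indep hm hH h (stronglyMeasurable_condExp.mono hm') (hm' _ hA) hB,
      setIntegral_condExp (hm'.trans hm) hgi hA]
  | compl E hE ih =>
    rw [setIntegral_compl (hle _ hE) hgi, setIntegral_compl (hle _ hE) hci, ih,
      integral_condExp (hm'.trans hm)]
  | iUnion f hd hf ih =>
    rw [integral_iUnion (fun i => hle _ (hf i)) hd hgi.integrableOn,
      integral_iUnion (fun i => hle _ (hf i)) hd hci.integrableOn]
    exact tsum_congr ih

/-- If `H` is independent of `m`, then an event determined by `H` and a sub-σ-algebra `m'` of `m`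
has the same conditional probability given `m` and given `m'`. -/
theorem condExp_indicator_eq_of_indep [IsProbabilityMeasure P] (hm : m ≤ mΩ) (hm' : m' ≤ m) (hH : H ≤ mΩ)
    (h : Indep m H P) {E : Set Ω} (hE : MeasurableSet[m' ⊔ H] E) :
    P⟦E | m⟧ =ᵐ[P] P⟦E | m'⟧ := by
  have hm'Ω := hm'.trans hm
  have hEΩ : MeasurableSet E := sup_le hm'Ω hH _ hE
  set η : Ω → ℝ := P⟦E | m'⟧
  have hη : StronglyMeasurable[m'] η := stronglyMeasurable_condExp
  have hηi : Integrable η P := integrable_condExp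
  have hE1 : Integrable (E.indicator fun _ => (1 : ℝ)) P := (integrable_const 1).indicator hEΩ
  refine (ae_eq_condExp_of_forall_setIntegral_eq hm hE1 (fun _ _ _ => hηi.integrableOn)
    (fun F hF _ => ?_) (hη.mono hm').aestronglyMeasurable).symm
  have hFΩ := hm _ hF
  set g : Ω → ℝ := F.indicator fun _ => (1 : ℝ)
  have hg : StronglyMeasurable[m] g := stronglyMeasurable_const.indicator hF
  have hgi : Integrable g P := (integrable_const 1).indicator hFΩ
  set φ : Ω → ℝ := P[g | m']
  have hφ : StronglyMeasurable[m'] φ := stronglyMeasurable_condExp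
  have hφi : Integrable φ P := integrable_condExp
  have eη : F.indicator η = g * η := by
    funext ω; by_cases hω : ω ∈ F <;> simp [g, hω]
  have eφ : E.indicator φ = φ * E.indicator fun _ => (1 : ℝ) := by
    funext ω; by_cases hω : ω ∈ E <;> simp [hω]
  have i1 : Integrable (g * η) P := eη ▸ hηi.indicator hFΩ
  have i2 : Integrable (φ * E.indicator fun _ => (1 : ℝ)) P := eφ ▸ hφi.indicator hEΩ
  -- Self-adjointness of conditioning on `m'` moves it from `E` to `F`; the independence lemma then
  -- removes it from `F`.
  calc ∫ ω in F, η ω ∂P = ∫ ω, (g * η) ω ∂P := by rw [← integral_indicator hFΩ, eη]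
    _ = ∫ ω, (φ * η) ω ∂P := by
      rw [← integral_condExp hm'Ω]
      exact integral_congr_ae (condExp_mul_of_stronglyMeasurable_right hη i1 hgi)
    _ = ∫ ω, (φ * E.indicator fun _ => (1 : ℝ)) ω ∂P := by
      rw [← integral_condExp (m := m') hm'Ω (f := φ * E.indicator fun _ => (1 : ℝ))]
      exact (integral_congr_ae (condExp_mul_of_stronglyMeasurable_left hφ i2 hE1)).symm
    _ = ∫ ω in E, φ ω ∂P := by rw [← integral_indicator hEΩ, eφ]
    _ = ∫ ω in E, g ω ∂P := (setIntegral_condExp_of_indep hm hm' hH h hg hgi hE).symm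
    _ = ∫ ω in F, E.indicator (fun _ => (1 : ℝ)) ω ∂P := by
      rw [setIntegral_indicator hFΩ, setIntegral_indicator hEΩ, inter_comm]

/-- Independence is insensitive to null sets. -/
theorem Indep.of_le_eventuallyMeasurableSpace (h : Indep m H P)
    (hle : m' ≤ eventuallyMeasurableSpace m (ae P)) : Indep m' H P := by
  rw [Indep_iff] at h ⊢
  intro A B hA hB
  obtain ⟨A', hA', hAA'⟩ := hle _ hA
  rw [measure_congr (hAA'.inter (ae_eq_refl B)), measure_congr hAA']
  exact h A' B hA' hB

/-- On the π-system of sets `A ∩ B`, peel off `A`, then separate `B` from `C`, then recombine `A`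
with `B`. -/
theorem Indep.sup_left_of_indep [IsProbabilityMeasure P] (hm : m ≤ mΩ) (hm' : m' ≤ mΩ)
    (hH : H ≤ mΩ) (h : Indep m (m' ⊔ H) P) (h' : Indep m' H P) : Indep (m ⊔ m') H P := by
  refine IndepSets.indep (sup_le hm hm') hH (isPiSystem_inter_measurableSet m m')
    (@MeasurableSpace.isPiSystem_measurableSet _ H) (sup_eq_generateFrom_inter m m')
    (@MeasurableSpace.generateFrom_measurableSet _ H).symm ?_
  rw [IndepSets_iff]
  rw [Indep_iff] at h h'
  rintro _ C ⟨A, B, hA, hB, rfl⟩ hC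
  have hB' : MeasurableSet[m' ⊔ H] B := (le_sup_left : m' ≤ m' ⊔ H) _ hB
  have hC' : MeasurableSet[m' ⊔ H] C := (le_sup_right : H ≤ m' ⊔ H) _ hC
  rw [inter_assoc, h A (B ∩ C) hA (hB'.inter hC'), h' B C hB hC, h A B hA hB', mul_assoc]

end ConditionalIndependence

/-! ### Independence of a Poisson random measure over disjoint regions -/

section Cells

variable {E ι : Type*}

/-- The cell of the partition of `S` generated by the sets `A i` in which the `i`-th membership is
prescribed by `c i`. -/
def cell (S : Set E) (A : ι → Set E) (c : ι → Bool) : Set E :=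
  S ∩ ⋂ i, {x | x ∈ A i ↔ c i = true}

theorem disjoint_cell (S : Set E) (A : ι → Set E) {c d : ι → Bool} (hcd : c ≠ d) :
    Disjoint (cell S A c) (cell S A d) := by
  refine Set.disjoint_left.2 fun x hc hd => hcd ?_
  funext i
  have h1 := mem_iInter.1 hc.2 i
  have h2 := mem_iInter.1 hd.2 i
  simp only [mem_ofPred_eq] at h1 h2
  exact Bool.eq_iff_iff.2 (h1.symm.trans h2)

variable [MeasurableSpace E]

theorem measurableSet_cell [Countable ι] {S : Set E} {A : ι → Set E} (hS : MeasurableSet S)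
    (hA : ∀ i, MeasurableSet (A i)) (c : ι → Bool) : MeasurableSet (cell S A c) := by
  refine hS.inter (MeasurableSet.iInter fun i => ?_)
  cases c i
  · convert (hA i).compl using 1
    ext x; simp
  · convert hA i using 1
    ext x; simp

/-- Poisson independence concerns disjoint sets; this expresses the masses of finitely many
overlapping sets through those of disjoint cells. -/
theorem measure_inter_eq_sum_cell [Fintype ι] [DecidableEq ι] (ν : Measure E) {S : Set E}
    {A : ι → Set E} (hS : MeasurableSet S) (hA : ∀ i, MeasurableSet (A i)) (i : ι) :
    ν (A i ∩ S) = ∑ c : ι → Bool with c i = true, ν (cell S A c) := by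
  classical
  rw [← measure_biUnion_finset (fun c _ d _ hcd => disjoint_cell S A hcd)
    fun c _ => measurableSet_cell hS hA c]
  congr 1
  ext x
  simp only [mem_inter_iff, mem_iUnion, Finset.mem_filter, Finset.mem_univ, true_and,
    exists_prop, cell, mem_iInter, mem_ofPred_eq]
  constructor
  · rintro ⟨hi, hx⟩
    exact ⟨fun j => decide (x ∈ A j), by simpa using hi, hx, fun j => by simp⟩
  · rintro ⟨c, hc, hx, hj⟩
    exact ⟨(hj i).2 hc, hx⟩

theorem measurable_measure_inter_of_cell {Ω : Type*} {m : MeasurableSpace Ω} [Fintype ι]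
    {N : Ω → Measure E} {S : Set E} {A : ι → Set E} (hS : MeasurableSet S)
    (hA : ∀ i, MeasurableSet (A i)) (h : ∀ c, Measurable fun ω => N ω (cell S A c)) :
    Measurable fun ω i => N ω (A i ∩ S) := by
  classical
  refine measurable_pi_iff.2 fun i => ?_
  simp_rw [measure_inter_eq_sum_cell _ hS hA i]
  exact Finset.measurable_fun_sum _ fun c _ => h c

end Cells

namespace IsPoissonRandomMeasure

variable {Ω E : Type*} [MeasurableSpace Ω] [MeasurableSpace E] {N : Ω → Measure E}
  {μ : Measure E} {P : Measure Ω}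

theorem measurable_apply (hN : IsPoissonRandomMeasure N μ P) {A : Set E} (hA : MeasurableSet A) :
    Measurable fun ω => N ω A :=
  (Measure.measurable_coe hA).comp hN.measurable

/-- The Poisson weights sum to one, leaving no probability for the value `∞`. -/
theorem ae_lt_top [IsProbabilityMeasure P] (hN : IsPoissonRandomMeasure N μ P) {A : Set E}
    (hA : MeasurableSet A) (hμ : μ A ≠ ∞) : ∀ᵐ ω ∂P, N ω A < ∞ := by
  have hmeas : ∀ n : ℕ, MeasurableSet {ω | N ω A = n} := fun n =>
    hN.measurable_apply hA (measurableSet_singleton _)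
  have hone : P (⋃ n : ℕ, {ω | N ω A = n}) = 1 := by
    rw [measure_iUnion _ hmeas]
    · simp_rw [hN.law_of_finite A hA hμ]
      have hs := hasSum_one_poissonMeasure (μ A).toNNReal
      refine (ENNReal.ofReal_tsum_of_nonneg (fun n => ?_) hs.summable).symm.trans ?_
      · positivity
      · exact (congrArg ENNReal.ofReal hs.tsum_eq).trans ENNReal.ofReal_one
    · intro i j hij
      refine Set.disjoint_left.2 fun ω hi hj => hij ?_
      simp only [mem_ofPred_eq] at hi hj
      exact_mod_cast hi.symm.trans hj
  have := (prob_compl_eq_zero_iff (MeasurableSet.iUnion hmeas)).2 hone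
  filter_upwards [compl_mem_ae_iff.2 this] with ω hω
  simp only [compl_compl, mem_iUnion, mem_ofPred_eq] at hω
  obtain ⟨n, hn⟩ := hω
  rw [hn]
  exact ENNReal.natCast_lt_top n

theorem iIndepFun_of_fintype (hN : IsPoissonRandomMeasure N μ P) {ι : Type*} [Fintype ι]
    {A : ι → Set E} (hA : ∀ i, MeasurableSet (A i)) (hd : Pairwise fun i j => Disjoint (A i) (A j)) :
    iIndepFun (fun i ω => N ω (A i)) P := by
  have e := (Fintype.equivFin ι).symm
  exact (iIndepFun_precomp_of_bijective e.bijective).1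
    (hN.indep _ (fun i => A (e i)) (fun i => hA _) fun i j hij => hd (e.injective.ne hij))

/-- The restrictions of a Poisson random measure to disjoint sets are independent. -/
theorem indep_restrict [IsProbabilityMeasure P] (hN : IsPoissonRandomMeasure N μ P) {S T : Set E}
    (hS : MeasurableSet S) (hT : MeasurableSet T) (hST : Disjoint S T) :
    Indep (MeasurableSpace.comap (fun ω => (N ω).restrict S) inferInstance)
      (MeasurableSpace.comap (fun ω => (N ω).restrict T) inferInstance) P := by
  classical
  let 𝒜 := {A : Set E // MeasurableSet A}
  have hcomap : ∀ S : Set E, MeasurableSpace.comap (fun ω => (N ω).restrict S) inferInstance ≤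
      MeasurableSpace.comap (fun ω (A : 𝒜) => N ω (A.1 ∩ S)) inferInstance := by
    intro S
    refine Measurable.comap_le (Measure.measurable_of_measurable_coe _ fun A hA => ?_)
    simp_rw [Measure.restrict_apply hA]
    exact (measurable_pi_apply (X := fun _ : 𝒜 => ℝ≥0∞) ⟨A, hA⟩).comp (comap_measurable _)
  refine indep_of_indep_of_le_left (indep_of_indep_of_le_right ?_ (hcomap T)) (hcomap S)
  rw [← IndepFun_iff_Indep]
  refine IndepFun.process_indepFun_process (𝓧 := fun _ : 𝒜 => ℝ≥0∞)
    (𝓨 := fun _ : 𝒜 => ℝ≥0∞) (X := fun (A : 𝒜) ω => N ω (A.1 ∩ S))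
    (Y := fun (A : 𝒜) ω => N ω (A.1 ∩ T))
    (fun A => hN.measurable_apply (A.2.inter hS)) (fun A => hN.measurable_apply (A.2.inter hT))
    fun I J => ?_
  have hI : ∀ i : I, MeasurableSet i.1.1 := fun i => i.1.2
  have hJ : ∀ j : J, MeasurableSet j.1.1 := fun j => j.1.2
  let atom : (I → Bool) ⊕ (J → Bool) → Set E :=
    Sum.elim (cell S fun i : I => i.1.1) (cell T fun j : J => j.1.1)
  have hatom : ∀ c, MeasurableSet (atom c) := by
    rintro (c | c)
    · exact measurableSet_cell hS hI c
    · exact measurableSet_cell hT hJ c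
  have hdisj : Pairwise fun c d => Disjoint (atom c) (atom d) := by
    rintro (c | c) (d | d) hcd
    · exact disjoint_cell _ _ fun h => hcd (congrArg _ h)
    · exact hST.mono inter_subset_left inter_subset_left
    · exact hST.symm.mono inter_subset_left inter_subset_left
    · exact disjoint_cell _ _ fun h => hcd (congrArg _ h)
  -- All cells of `S` and `T` together form one disjoint, hence independent, family; grouping by
  -- side preserves independence.
  have hindep := indep_iSup_of_disjoint (fun c => (hN.measurable_apply (hatom c)).comap_le)
    ((iIndepFun_iff_iIndep _ _ _).1 (hN.iIndepFun_of_fintype hatom hdisj))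
    (isCompl_range_inl_range_inr (α := I → Bool) (β := J → Bool)).disjoint
  have hcell : ∀ (R : Set ((I → Bool) ⊕ (J → Bool))), ∀ c ∈ R,
      Measurable[⨆ c ∈ R, MeasurableSpace.comap (fun ω => N ω (atom c)) inferInstance]
        fun ω => N ω (atom c) := fun R c hc =>
    Measurable.of_comap_le (le_iSup₂_of_le c hc le_rfl)
  rw [IndepFun_iff_Indep]
  refine indep_of_indep_of_le_left (indep_of_indep_of_le_right hindep ?_) ?_
  · exact (measurable_measure_inter_of_cell hT hJ
      fun c => hcell _ (Sum.inr c) (mem_range_self c)).comap_le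
  · exact (measurable_measure_inter_of_cell hS hI
      fun c => hcell _ (Sum.inl c) (mem_range_self c)).comap_le

end IsPoissonRandomMeasure

end

/-! ### The solution as a measurable functional, and the Markov property -/

noncomputable section

variable {k : ℕ} {lam : Fin k → Fin k → ℝ → ℝ}

/-- A random measure cut off where its total mass is at least `n`, as a kernel. -/
def truncatedKernel {α E : Type*} [MeasurableSpace α] [MeasurableSpace E] (R : α → Measure E)
    (hR : Measurable R) (n : ℕ) : Kernel α E where
  toFun a := by classical exact if R a univ < n then R a else 0
  measurable' := by
    classical
    exact Measurable.ite (measurableSet_lt ((Measure.measurable_coe MeasurableSet.univ).comp hR)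
      measurable_const) hR measurable_const

theorem truncatedKernel_apply_of_lt {α E : Type*} [MeasurableSpace α] [MeasurableSpace E]
    {R : α → Measure E} (hR : Measurable R) {n : ℕ} {a : α} (h : R a univ < n) :
    truncatedKernel R hR n a = R a :=
  if_pos h

instance {α E : Type*} [MeasurableSpace α] [MeasurableSpace E] (R : α → Measure E)
    (hR : Measurable R) (n : ℕ) : IsFiniteKernel (truncatedKernel R hR n) := by
  refine ⟨⟨n, ENNReal.natCast_lt_top n, fun a => ?_⟩⟩
  by_cases h : R a univ < n
  · rw [truncatedKernel_apply_of_lt hR h]; exact h.le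
  · have : truncatedKernel R hR n a = 0 := if_neg h
    simp [this]

/-- The solution at time `t` is a measurable function of the solution at time `s` and of the driving
measure. -/
theorem IsRateFunction.exists_measurable_solution (h : IsRateFunction lam) {α : Type*}
    {mα : MeasurableSpace α} {R : α → Measure (ℝ≥0 × ℝ)} (hR : Measurable R)
    {z : α → Fin k × ℝ≥0} (hz : Measurable z) {s t : ℝ≥0} (hst : s ≤ t) :
    ∃ W : α → Fin k × ℝ≥0, Measurable W ∧ ∀ a x y, R a univ < ∞ →
      (∀ A, MeasurableSet A → ∃ n : ℕ∞, R a A = (n : ℝ≥0∞)) → SolvesOn lam (R a) s t x y →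
      IsRCLL x → IsRCLL y → z a = (x s, y s) → W a = (x t, y t) := by
  -- Truncating at mass `n` gives a finite kernel, as the measurability of the Picard iterates
  -- requires s-finiteness.
  obtain ⟨V, hV, hVeq⟩ : ∃ V : ℕ → α → Fin k × ℝ≥0, (∀ n, Measurable (V n)) ∧ ∀ n a,
      V n a = solutionStep lam (truncatedKernel R hR n a) s (z a)
        (picardIter lam (truncatedKernel R hR n a) s (z a) n) (Ioc s t) t := by
    refine ⟨fun n a => solutionStep lam (truncatedKernel R hR n a) s (z a)
      (picardIter lam (truncatedKernel R hR n a) s (z a) n) (Ioc s t) t,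
      fun n => ?_, fun _ _ => rfl⟩
    have hA : MeasurableSet {q : ℝ≥0 × ℝ≥0 | q.2 ∈ Ioc s t} :=
      measurableSet_Ioc.preimage measurable_snd
    have h1 := h.measurable_solutionStep (truncatedKernel R hR n) s hz
      (φ := fun a => picardIter lam (truncatedKernel R hR n a) s (z a) n)
      (h.measurable_picardIter _ s hz n) (A := fun _ => Ioc s t) hA
    have h2 := h1.comp (measurable_id.prodMk (measurable_const (a := t)))
    simp only [Function.comp_def, id] at h2
    exact h2
  -- A measurable choice of truncation level and iteration count exceeding the total mass whenever
  -- that is finite.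
  let n : α → ℕ := fun a => ⌊(R a univ).toReal⌋₊ + 1
  have hn : Measurable n := by
    have h1 : Measurable fun a => (R a univ).toReal :=
      ((Measure.measurable_coe MeasurableSet.univ).comp hR).ennreal_toReal
    exact (measurable_of_countable fun m : ℕ => m + 1).comp (Nat.measurable_floor.comp h1)
  refine ⟨fun a => V (n a) a, ?_, fun a x y hfin hint hsol hx hy hza => ?_⟩
  · have : Measurable fun p : ℕ × α => V p.1 p.2 := measurable_from_prod_countable_right hV
    exact this.comp (hn.prodMk measurable_id)
  · have hlt : R a univ < (n a : ℝ≥0∞) := by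
      rw [← ENNReal.ofReal_toReal hfin.ne, ← ENNReal.ofReal_natCast]
      refine (ENNReal.ofReal_lt_ofReal_iff (by positivity)).2 ?_
      exact_mod_cast Nat.lt_floor_add_one _
    beta_reduce
    rw [hVeq, truncatedKernel_apply_of_lt hR hlt, hza]
    exact hsol.solutionStep_picardIter hint hst hx hy _ hlt

/-- Additivity in time; cutting `ν` down to the strip over `B` loses nothing because `F` vanishes
off it. -/
theorem setIntegral_Ioc_add_of_strip {ν : Measure (ℝ≥0 × ℝ)} {F : ℝ≥0 × ℝ → ℝ} {B : Set ℝ}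
    (hF : ∀ p, p.2 ∉ B → F p = 0) {s t u : ℝ≥0} (hu : u ∈ Icc s t)
    (hint : IntegrableOn F (Ioc 0 t ×ˢ univ) ν) :
    ∫ p in Ioc 0 u ×ˢ univ, F p ∂ν = ∫ p in Ioc 0 s ×ˢ univ, F p ∂ν +
      ∫ p in Ioc s u ×ˢ univ, F p ∂(ν.restrict (Ioc s t ×ˢ B)) := by
  have hm : ∀ a b, MeasurableSet (Ioc a b ×ˢ (univ : Set ℝ)) := fun a b : ℝ≥0 =>
    measurableSet_Ioc.prod MeasurableSet.univ
  have h1 : ∫ p in Ioc s u ×ˢ univ, F p ∂(ν.restrict (Ioc s t ×ˢ B)) =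
      ∫ p in Ioc s u ×ˢ univ, F p ∂ν := by
    rw [Measure.restrict_restrict (hm s u), prod_inter_prod, univ_inter,
      inter_eq_left.2 (Ioc_subset_Ioc_right hu.2)]
    exact (setIntegral_eq_of_subset_of_forall_sdiff_eq_zero (hm s u)
      (prod_mono_right (subset_univ _)) fun p hp => hF p fun hpB => hp.2 ⟨hp.1.1, hpB⟩).symm
  rw [h1, ← Ioc_union_Ioc_eq_Ioc (zero_le (a := s)) hu.1, union_prod]
  refine setIntegral_union ?_ (hm s u) (hint.mono_set ?_) (hint.mono_set ?_)
  · refine Disjoint.set_prod_left ?_ _ _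
    rw [Set.disjoint_left]
    exact fun v hv hv' => hv.2.not_gt hv'.1
  · exact prod_mono_left (Ioc_subset_Ioc_right (hu.1.trans hu.2))
  · exact prod_mono_left (Ioc_subset_Ioc (zero_le (a := s)) hu.2)

theorem intensity_prod_ne_top (s t : ℝ≥0) (C : ℝ) : intensity (Ioc s t ×ˢ Ico 0 C) ≠ ∞ := by
  rw [intensity, Measure.prod_prod]
  refine ENNReal.mul_ne_top ?_ (by simp)
  have hemb : MeasurableEmbedding ((↑) : ℝ≥0 → ℝ) :=
    MeasurableEmbedding.subtype_coe measurableSet_Ici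
  rw [hemb.comap_apply]
  refine ((measure_mono (image_subset_iff.2 fun u hu => ?_)).trans_lt
    (measure_Icc_lt_top (a := (s : ℝ)) (b := t))).ne
  exact ⟨NNReal.coe_le_coe.2 hu.1.le, NNReal.coe_le_coe.2 hu.2⟩

section Restrict

variable {Ω E : Type*} [MeasurableSpace E] {S T : Set E}

theorem measurable_measure_restrict (hS : MeasurableSet S) :
    Measurable fun μ : Measure E => μ.restrict S := by
  refine Measure.measurable_of_measurable_coe _ fun A hA => ?_
  simp_rw [Measure.restrict_apply hA]
  exact Measure.measurable_coe (hA.inter hS)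

theorem comap_restrict_le (N : Ω → Measure E) (hS : MeasurableSet S) :
    MeasurableSpace.comap (fun ω => (N ω).restrict S) inferInstance ≤
      MeasurableSpace.comap N inferInstance :=
  ((measurable_measure_restrict hS).comp (comap_measurable N)).comap_le

theorem comap_restrict_mono (N : Ω → Measure E) (hS : MeasurableSet S) (hST : S ⊆ T) :
    MeasurableSpace.comap (fun ω => (N ω).restrict S) inferInstance ≤
      MeasurableSpace.comap (fun ω => (N ω).restrict T) inferInstance := by
  have h := comap_restrict_le (fun ω => (N ω).restrict T) hS
  simp only [Measure.restrict_restrict_of_subset hST] at h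
  exact h

end Restrict

variable {Ω : Type*} {mΩ : MeasurableSpace Ω} {P : Measure Ω} {N : Ω → Measure (ℝ≥0 × ℝ)}
  {ℱ : Filtration ℝ≥0 mΩ} {X : ℝ≥0 → Ω → Fin k} {Y : ℝ≥0 → Ω → ℝ≥0}

/-- Subtracting the equations at `s` from those at `u` restarts the solution at time `s`. -/
theorem IsStrongSolution.ae_solvesOn (hXY : IsStrongSolution lam N ℱ P X Y) {B : Set ℝ}
    (hzero : ∀ i y z, z ∉ B → jumpX lam i y z = 0 ∧ jumpY lam i y z = 0) (s t : ℝ≥0) :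
    ∀ᵐ ω ∂P, SolvesOn lam ((N ω).restrict (Ioc s t ×ˢ B)) s t (fun u => X u ω)
      (fun u => Y u ω) := by
  filter_upwards [hXY.eq_fst, hXY.eq_snd] with ω h1 h2
  have hsub : Ioc s t ×ˢ B ⊆ Ioc 0 t ×ˢ univ :=
    prod_mono (Ioc_subset_Ioc_left (zero_le (a := s))) (subset_univ _)
  refine ⟨(h1 t).1.mono_set hsub, (h2 t).1.mono_set hsub, fun u hu => ?_, fun u hu => ?_⟩
  · have := setIntegral_Ioc_add_of_strip (fun p hp => (hzero _ _ _ hp).1) hu (h1 t).1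
    rw [(h1 u).2, (h1 s).2, this, add_assoc]
  · have := setIntegral_Ioc_add_of_strip (fun p hp => (hzero _ _ _ hp).2) hu (h2 t).1
    rw [(h2 u).2, (h2 s).2, this]
    ring

/-- Up to null sets, the solution at time `t` is determined by the solution at time `s` and by the
restriction of the driving measure to `(s, t] × ℝ`. -/
theorem IsStrongSolution.exists_ae_eq [IsProbabilityMeasure P]
    (hXY : IsStrongSolution lam N ℱ P X Y) (hlam : IsRateFunction lam)
    (hN : IsPoissonRandomMeasure N intensity P) {s t : ℝ≥0} (hst : s ≤ t) :
    ∃ W : Ω → Fin k × ℝ≥0,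
      Measurable[MeasurableSpace.comap (augmented X Y s) inferInstance ⊔
        MeasurableSpace.comap (fun ω => (N ω).restrict (Ioc s t ×ˢ univ)) inferInstance] W ∧
      augmented X Y t =ᵐ[P] W := by
  obtain ⟨C, hC⟩ := hlam.exists_jump_eq_zero
  have hbox : MeasurableSet (Ioc s t ×ˢ Ico (0 : ℝ) C) := measurableSet_Ioc.prod measurableSet_Ico
  obtain ⟨W, hW, hWeq⟩ := hlam.exists_measurable_solution
    -- `Ω` itself serves as parameter space, with the σ-algebra generated by `Z_s` and the noise on
    -- `(s, t]`; measurability of `W` is then the required one.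
    (mα := MeasurableSpace.comap (augmented X Y s) inferInstance ⊔
      MeasurableSpace.comap (fun ω => (N ω).restrict (Ioc s t ×ˢ univ)) inferInstance)
    (Measurable.of_comap_le ((comap_restrict_mono N hbox
      (prod_mono_right (subset_univ _))).trans le_sup_right))
    (Measurable.of_comap_le le_sup_left) hst
  refine ⟨W, hW, ?_⟩
  filter_upwards [hXY.ae_solvesOn hC s t, hXY.rcll_fst, hXY.rcll_snd,
    hN.ae_lt_top hbox (intensity_prod_ne_top s t C)] with ω hsol hx hy hfin
  refine (hWeq ω _ _ (by simpa using hfin) (fun A hA => ?_) hsol hx hy rfl).symm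
  rw [Measure.restrict_apply hA]
  exact hN.integer_valued ω _ (hA.inter hbox)

/-- A strong solution is Markov relative to every filtration to which it is adapted and of which the
future of the driving measure is independent. -/
theorem IsStrongSolution.isMarkovProcess [IsProbabilityMeasure P]
    (hXY : IsStrongSolution lam N ℱ P X Y) (hlam : IsRateFunction lam)
    (hN : IsPoissonRandomMeasure N intensity P) {𝒢 : Filtration ℝ≥0 mΩ}
    (hadapted : ∀ t, Measurable[𝒢 t] (augmented X Y t)) (hind : HasFutureIndepOf N 𝒢 P) :
    IsMarkovProcess (augmented X Y) 𝒢 P := by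
  refine ⟨hadapted, fun s t hst A hA => ?_⟩
  obtain ⟨W, hW, hWeq⟩ := hXY.exists_ae_eq hlam hN hst.le
  have hIoc : MeasurableSet (Ioc s t ×ˢ (univ : Set ℝ)) := measurableSet_Ioc.prod MeasurableSet.univ
  have hae : (augmented X Y t ⁻¹' A).indicator (fun _ => (1 : ℝ)) =ᵐ[P]
      (W ⁻¹' A).indicator fun _ => (1 : ℝ) :=
    indicator_ae_eq_of_ae_eq_set (hWeq.preimage A)
  calc P⟦augmented X Y t ⁻¹' A | 𝒢 s⟧ =ᵐ[P] P⟦W ⁻¹' A | 𝒢 s⟧ := condExp_congr_ae hae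
    _ =ᵐ[P] P⟦W ⁻¹' A | MeasurableSpace.comap (augmented X Y s) inferInstance⟧ :=
      condExp_indicator_eq_of_indep (𝒢.le s) (hadapted s).comap_le
        ((comap_restrict_le N hIoc).trans hN.measurable.comap_le)
        (indep_of_indep_of_le_right (hind s)
          (comap_restrict_mono N hIoc (prod_mono_left Ioc_subset_Ioi_self))) (hW hA)
    _ =ᵐ[P] P⟦augmented X Y t ⁻¹' A | MeasurableSpace.comap (augmented X Y s) inferInstance⟧ :=
      condExp_congr_ae hae.symm

theorem IsStrongSolution.hasFutureIndepOf_generatedFiltration [IsProbabilityMeasure P]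
    (hXY : IsStrongSolution lam N ℱ P X Y) (hlam : IsRateFunction lam)
    (hN : IsPoissonRandomMeasure N intensity P) (h0 : IndepFun (augmented X Y 0) N P) :
    HasFutureIndepOf N (generatedFiltration (augmented X Y) hXY.measurable_augmented) P := by
  intro s
  have hIoc : ∀ u : ℝ≥0, MeasurableSet (Ioc 0 u ×ˢ (univ : Set ℝ)) := fun _ =>
    measurableSet_Ioc.prod MeasurableSet.univ
  have hIoi : MeasurableSet (Ioi s ×ˢ (univ : Set ℝ)) := measurableSet_Ioi.prod MeasurableSet.univ
  have hdisj : Disjoint (Ioc 0 s ×ˢ (univ : Set ℝ)) (Ioi s ×ˢ univ) :=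
    Disjoint.set_prod_left (by
      rw [Set.disjoint_left]; exact fun u hu hu' => hu.2.not_gt hu') _ _
  have hpast := comap_restrict_le N (hIoc s)
  have hfuture := comap_restrict_le N hIoi
  have hindep := Indep.sup_left_of_indep (hXY.measurable_augmented 0).comap_le
    (hpast.trans hN.measurable.comap_le) (hfuture.trans hN.measurable.comap_le)
    (indep_of_indep_of_le_right ((IndepFun_iff_Indep _ _ _).1 h0) (sup_le hpast hfuture))
    (hN.indep_restrict (hIoc s) hIoi hdisj)
  -- Each `Z_u`, `u ≤ s`, is only almost surely a function of `Z_0` and `N` on `(0, u]`, so the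
  -- history lies in their σ-algebra up to null sets.
  refine Indep.of_le_eventuallyMeasurableSpace hindep (iSup₂_le fun u hu => ?_)
  obtain ⟨W, hW, hWeq⟩ := hXY.exists_ae_eq hlam hN (zero_le (a := u))
  rintro _ ⟨A, hA, rfl⟩
  exact ⟨W ⁻¹' A, sup_le_sup_left
    (comap_restrict_mono N (hIoc u) (prod_mono_left (Ioc_subset_Ioc_right hu))) _ _ (hW hA),
    hWeq.preimage A⟩

end

theorem mainTheorem9 {Ω : Type*} {mΩ : MeasurableSpace Ω} (P : Measure Ω) [IsProbabilityMeasure P]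
    (ℱ : Filtration ℝ≥0 mΩ) {k : ℕ} (lam : Fin k → Fin k → ℝ → ℝ) (hlam : IsRateFunction lam)
    (N : Ω → Measure (ℝ≥0 × ℝ))
    (hN : IsPoissonRandomMeasure N intensity P)
    (hNℱ : IsAdaptedRandomMeasure N ℱ)
    (X : ℝ≥0 → Ω → Fin k) (Y : ℝ≥0 → Ω → ℝ≥0) (hXY : IsStrongSolution lam N ℱ P X Y) :
    (HasFutureIndepOf N ℱ P → IsMarkovProcess (augmented X Y) ℱ P) ∧
    (IndepFun (augmented X Y 0) N P →
      IsMarkovProcess (augmented X Y)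
        (generatedFiltration (augmented X Y) hXY.measurable_augmented) P) := by
  exact ⟨fun hind => hXY.isMarkovProcess hlam hN
      (fun t => (hXY.adapted_fst t).prodMk (hXY.adapted_snd t)) hind,
    fun h0 => hXY.isMarkovProcess hlam hN
      (fun t => Measurable.of_comap_le (le_iSup₂_of_le t le_rfl le_rfl))
      (hXY.hasFutureIndepOf_generatedFiltration hlam hN h0)⟩
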